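/- Let $\Gamma$ be a finite simple graph. Its two-particle discrete configuration space $D_2(\Gamma)$ is the cubical complex whose cells are the unordered pairs of disjoint closed cells of $\Gamma$: the $0$-cells are $\{w,w'\}$ with $w\neq w'$ vertices, the $1$-cells are $\{e,w\}$ with $e$ an edge and $w\notin e$ a vertex, and the $2$-cells are $\{e,e'\}$ with $e,e'$ disjoint edges. Fix any linear order of the vertices; write $\iota(e)>\tau(e)$ for the endpoints of an edge $e$, and put $\partial e=\iota(e)-\tau(e)$, $\partial\{e,w\}=-(\{\iota(e),w\}-\{\tau(e),w\})$ and, for $\tau(e)<\tau(e')$, $\partial\{e,e'\}=-(\{\iota(e),e'\}-\{\tau(e),e'\})+(\{e,\iota(e')\}-\{e,\tau(e')\})$. Let $\beta_i$ denote the rank of the $i$-th integral homology group of the resulting cellular chain complexes of $\Gamma$ and $D_2(\Gamma)$. Let $v$ be a vertex of $\Gamma$, and let $\Gamma$ be the wedge sum at $v$ of subgraphs (components) $\Gamma_1,\dots,\Gamma_k$: their union is $\Gamma$, and any two of them have exactly the vertex $v$ (and no edge) in common. (If at least two components contain a vertex other than $v$, then removing $v$ disconnects $\Gamma$; every one-connected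 graph is such a wedge sum at a cut vertex $v$.) Let $\tilde\Gamma_i$ be $\Gamma_i$ with the vertex $v$ and all edges at $v$ removed, and let $\mu_i=\beta_1(\Gamma_i)-\beta_1(\tilde\Gamma_i)$. (1) If there are two components $\Gamma_1$ and $\Gamma_2$, then $$\beta_2(D_2(\Gamma))=\beta_2(D_2(\Gamma_1))+\beta_2(D_2(\Gamma_2))+\beta_1(\tilde\Gamma_1)\beta_1(\Gamma_2)+\beta_1(\Gamma_1)\beta_1(\tilde\Gamma_2)-\beta_1(\tilde\Gamma_1)\beta_1(\tilde\Gamma_2).$$ (2) For any finite number $k$ of components, $$\beta_2(D_2(\Gamma))=\sum_{i}\beta_2(D_2(\Gamma_i))+\sum_{i<j}\bigl(\beta_1(\Gamma_i)\beta_1(\Gamma_j)-\mu_i\mu_j\bigr).$$ -/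

import Mathlib

/-!
Cellular chain complexes (over `ℤ`) of a simple graph and of its two-particle discrete
configuration space `D₂`, their Betti numbers, and wedge decompositions of a graph at a vertex.
The vertices are linearly ordered; the order is only used to orient the cells.
-/

namespace GraphConfig

/-- The rank of `ker g / im f` for `A --f--> B --g--> C`. -/
noncomputable def homologyRank {A B C : Type*} [AddCommGroup A] [AddCommGroup B] [AddCommGroup C]
    (f : A →ₗ[ℤ] B) (g : B →ₗ[ℤ] C) : ℕ :=
  Module.finrank ℤ (LinearMap.ker g ⧸ (LinearMap.range f).submoduleOf (LinearMap.ker g))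

section

variable {V : Type*} [LinearOrder V]

/-- An edge of `G`, recorded as the pair `(ι(e), τ(e))` of its endpoints with `ι(e) > τ(e)`;
every edge of `G` occurs exactly once. -/
abbrev Edge (G : SimpleGraph V) : Type _ := {p : V × V // G.Adj p.1 p.2 ∧ p.2 < p.1}

/-- The initial vertex of an edge. -/
def Edge.ini {G : SimpleGraph V} (e : Edge G) : V := e.1.1

/-- The terminal vertex of an edge. -/
def Edge.ter {G : SimpleGraph V} (e : Edge G) : V := e.1.2

theorem Edge.ini_ne_ter {G : SimpleGraph V} (e : Edge G) : e.ini ≠ e.ter := e.2.2.ne'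

/-- The vertex `w` does not lie on the closed edge `e`. -/
def Edge.Avoids {G : SimpleGraph V} (e : Edge G) (w : V) : Prop := w ≠ e.ini ∧ w ≠ e.ter

/-- Two closed edges are disjoint, `e ∩ e' = ∅`. -/
def Edge.DisjointFrom {G : SimpleGraph V} (e e' : Edge G) : Prop :=
  e.Avoids e'.ini ∧ e.Avoids e'.ter

/-! ### The graph as a one-dimensional complex -/

/-- `∂ e = ι(e) - τ(e)`. -/
noncomputable def graphBoundary (G : SimpleGraph V) : (Edge G →₀ ℤ) →ₗ[ℤ] (V →₀ ℤ) :=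
  Finsupp.linearCombination ℤ fun e => Finsupp.single e.ini 1 - Finsupp.single e.ter 1

/-- `β₁(G)`, the rank of `H₁(G) = ker ∂₁ / im ∂₂`; there are no `2`-cells. -/
noncomputable def betti₁ (G : SimpleGraph V) : ℕ :=
  homologyRank (0 : (Empty →₀ ℤ) →ₗ[ℤ] (Edge G →₀ ℤ)) (graphBoundary G)

/-! ### The two-particle discrete configuration space `D₂(G)` -/

/-- `0`-cells `{w, w'}`, `w ≠ w'`. -/
abbrev Cell₀ (_G : SimpleGraph V) : Type _ := {s : Sym2 V // ¬ s.IsDiag}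

/-- `1`-cells `{e, w}`, `e ∩ w = ∅`. -/
abbrev Cell₁ (G : SimpleGraph V) : Type _ := {p : Edge G × V // p.1.Avoids p.2}

/-- `2`-cells `{e, e'}`, `e ∩ e' = ∅`. Disjoint edges have distinct terminal vertices, so every
unordered pair is listed exactly once, namely as `(e, e')` with `τ(e) < τ(e')`. -/
abbrev Cell₂ (G : SimpleGraph V) : Type _ :=
  {p : Edge G × Edge G // p.1.DisjointFrom p.2 ∧ p.1.ter < p.2.ter}

/-- The `0`-cell `{w, w'}`. -/
def mkCell₀ (G : SimpleGraph V) (w w' : V) (h : w ≠ w') : Cell₀ G :=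
  ⟨s(w, w'), by simpa using h⟩

/-- The `1`-cell `{e, w}`. -/
def mkCell₁ {G : SimpleGraph V} (e : Edge G) (w : V) (h : e.Avoids w) : Cell₁ G := ⟨(e, w), h⟩

theorem Edge.DisjointFrom.symm {G : SimpleGraph V} {e e' : Edge G} (h : e.DisjointFrom e') :
    e'.DisjointFrom e :=
  ⟨⟨h.1.1.symm, h.2.1.symm⟩, ⟨h.1.2.symm, h.2.2.symm⟩⟩

/-- `∂ {e, w} = -({ι(e), w} - {τ(e), w})`. -/
noncomputable def confBoundary₁ (G : SimpleGraph V) : (Cell₁ G →₀ ℤ) →ₗ[ℤ] (Cell₀ G →₀ ℤ) :=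
  Finsupp.linearCombination ℤ fun c =>
    -(Finsupp.single (mkCell₀ G c.1.1.ini c.1.2 c.2.1.symm) 1
      - Finsupp.single (mkCell₀ G c.1.1.ter c.1.2 c.2.2.symm) 1)

/-- For `τ(e) < τ(e')`,
`∂ {e, e'} = -({ι(e), e'} - {τ(e), e'}) + ({e, ι(e')} - {e, τ(e')})`. -/
noncomputable def confBoundary₂ (G : SimpleGraph V) : (Cell₂ G →₀ ℤ) →ₗ[ℤ] (Cell₁ G →₀ ℤ) :=
  Finsupp.linearCombination ℤ fun c =>
    -(Finsupp.single (mkCell₁ c.1.2 c.1.1.ini c.2.1.symm.1) 1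
      - Finsupp.single (mkCell₁ c.1.2 c.1.1.ter c.2.1.symm.2) 1)
    + (Finsupp.single (mkCell₁ c.1.1 c.1.2.ini c.2.1.1) 1
      - Finsupp.single (mkCell₁ c.1.1 c.1.2.ter c.2.1.2) 1)

/-- `∂₁ ∘ ∂₂ = 0`. -/
theorem confBoundary₁_comp_confBoundary₂ (G : SimpleGraph V) :
    confBoundary₁ G ∘ₗ confBoundary₂ G = 0 := by
  have hswap : ∀ (w w' : V) (h : w ≠ w'), mkCell₀ G w w' h = mkCell₀ G w' w h.symm :=
    fun w w' h => Subtype.ext Sym2.eq_swap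
  ext1 c
  ext1
  simp only [LinearMap.comp_apply, Finsupp.lsingle_apply, confBoundary₂, confBoundary₁,
    Finsupp.linearCombination_single, one_smul, map_add, map_sub, map_neg, mkCell₁,
    LinearMap.zero_apply]
  rw [hswap c.1.2.ini c.1.1.ini, hswap c.1.2.ini c.1.1.ter, hswap c.1.2.ter c.1.1.ini,
    hswap c.1.2.ter c.1.1.ter]
  abel

/-- `β₂(D₂(G))`, the rank of `H₂(D₂(G)) = ker ∂₂ / im ∂₃`; there are no `3`-cells. -/
noncomputable def betti₂D₂ (G : SimpleGraph V) : ℕ :=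
  homologyRank (0 : (Empty →₀ ℤ) →ₗ[ℤ] (Cell₂ G →₀ ℤ)) (confBoundary₂ G)

end

/-- `G` is the wedge sum at `v` of the family of subgraphs `Γ i` (the components of `G` at `v`):
together they make up `G`, and any two of them share exactly the vertex `v`. -/
structure IsWedge {V : Type*} {ι : Type*} (G : SimpleGraph V) (v : V) (Γ : ι → G.Subgraph) :
    Prop where
  iSup_eq_top : ⨆ i, Γ i = ⊤
  inf_eq_singleton : ∀ i j, i ≠ j → Γ i ⊓ Γ j = G.singletonSubgraph v

/-- The component with the vertex `v` and all edges at `v` removed. -/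
def cut {V : Type*} {G : SimpleGraph V} (H : G.Subgraph) (v : V) : G.Subgraph :=
  H.deleteVerts {v}

/-- `μ = β₁(Γᵢ) - β₁(Γ̃ᵢ)`. -/
noncomputable def mu {V : Type*} [LinearOrder V] {G : SimpleGraph V} (H : G.Subgraph) (v : V) : ℤ :=
  (betti₁ H.coe : ℤ) - betti₁ (cut H v).coe

end GraphConfig

/-! There are no 3-cells, so the second Betti number of D₂ is the rank of `ker ∂₂`. Write a 2-chain
as an antisymmetric function A on ordered pairs of edges, supported on disjoint pairs. Up to sign,
the coefficient of {f, w} in ∂A is that of w in the boundary of A(·, f). Hence A is a cycle exactly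
when every slice A(·, f) is a 1-cycle of the graph (`sum_antisymm_incidence`).

At a wedge vertex v, the restriction of a 1-cycle to one component is again a 1-cycle
(`MeetOnlyAt.sum_filter_eq_zero`). So A splits into blocks A_ij indexed by pairs of components. The
diagonal blocks are the 2-cycles of the D₂(Γᵢ), and by antisymmetry only the blocks with i < j
remain (`MeetOnlyAt.finrank_pairCycles`).

Edges of different components fail to be disjoint exactly when both contain v. With Zᵢ the 1-cycles
of Γᵢ, a mixed block is therefore a function, in Zᵢ in one variable and in Zⱼ in the other, that
vanishes on pairs of edges at v. Restricting Zᵢ to the edges at v has the cycles of the cut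
component as kernel, hence image of rank μᵢ. The vanishing condition thus costs rank μᵢμⱼ out of
β₁(Γᵢ)β₁(Γⱼ) (`finrank_biVanishingOn`). Summing gives (2), and (1) is the case k = 2. -/

namespace GraphConfig

/-! ### Cycles as functions on edges and on pairs of edges -/

section Cycles

variable {V : Type*} [LinearOrder V]

/-- The coefficient of the vertex `w` in `∂ e`. -/
def Edge.incidence {G : SimpleGraph V} (e : Edge G) (w : V) : ℤ :=
  (if w = e.ini then 1 else 0) - (if w = e.ter then 1 else 0)

theorem Edge.incidence_eq_zero {G : SimpleGraph V} {e : Edge G} {w : V} (h : e.Avoids w) :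
    e.incidence w = 0 := by
  simp [Edge.incidence, h.1, h.2]

theorem Edge.DisjointFrom.ter_ne {G : SimpleGraph V} {e f : Edge G} (h : e.DisjointFrom f) :
    e.ter ≠ f.ter := h.2.2.symm

/-- Integral `1`-cycles of `G` supported on the set `S` of edges. -/
def cycles {G : SimpleGraph V} [Fintype (Edge G)] (S : Set (Edge G)) :
    Submodule ℤ (Edge G → ℤ) where
  carrier := {z | (∀ e ∉ S, z e = 0) ∧ ∀ w, ∑ e, z e * e.incidence w = 0}
  zero_mem' := by simp
  add_mem' := by
    rintro a b ⟨ha, ha'⟩ ⟨hb, hb'⟩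
    refine ⟨fun e he => by simp [ha e he, hb e he], fun w => ?_⟩
    simp [add_mul, Finset.sum_add_distrib, ha' w, hb' w]
  smul_mem' := by
    rintro c a ⟨ha, ha'⟩
    refine ⟨fun e he => by simp [ha e he], fun w => ?_⟩
    simp [mul_assoc, ← Finset.mul_sum, ha' w]

/-- `2`-cycles of `D₂`, as antisymmetric functions on ordered pairs of disjoint edges in `S`. -/
def pairCycles {G : SimpleGraph V} [Fintype (Edge G)] (S : Set (Edge G)) :
    Submodule ℤ (Edge G × Edge G → ℤ) where
  carrier := {A | (∀ e f, A (e, f) = -A (f, e)) ∧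
    (∀ e f, ¬ (e ∈ S ∧ f ∈ S ∧ e.DisjointFrom f) → A (e, f) = 0) ∧
    ∀ f w, ∑ e, A (e, f) * e.incidence w = 0}
  zero_mem' := by simp
  add_mem' := by
    rintro a b ⟨ha, ha', ha''⟩ ⟨hb, hb', hb''⟩
    refine ⟨fun e f => ?_, fun e f h => by simp [ha' e f h, hb' e f h], fun f w => ?_⟩
    · simp only [Pi.add_apply]
      rw [ha e f, hb e f]
      ring
    · simp [add_mul, Finset.sum_add_distrib, ha'' f w, hb'' f w]
  smul_mem' := by
    rintro c a ⟨ha, ha', ha''⟩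
    refine ⟨fun e f => ?_, fun e f h => by simp [ha' e f h], fun f w => ?_⟩
    · simp only [Pi.smul_apply, smul_eq_mul]
      rw [ha e f]
      ring
    · simp [mul_assoc, ← Finset.mul_sum, ha'' f w]

theorem homologyRank_zero_left {A B C : Type*} [AddCommGroup A] [AddCommGroup B] [AddCommGroup C]
    (g : B →ₗ[ℤ] C) :
    homologyRank (0 : A →ₗ[ℤ] B) g = Module.finrank ℤ (LinearMap.ker g) := by
  have h : (LinearMap.range (0 : A →ₗ[ℤ] B)).submoduleOf (LinearMap.ker g) = ⊥ := by
    simp [LinearMap.range_zero, Submodule.submoduleOf]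
  exact (Submodule.quotEquivOfEqBot _ h).finrank_eq

variable {W : Type*} [LinearOrder W] {H : SimpleGraph W} {G : SimpleGraph V}

/-- A strictly monotone graph homomorphism maps edges to edges, with their orientation. -/
def Edge.map (φ : H →g G) (hφ : StrictMono φ) (e : Edge H) : Edge G :=
  ⟨(φ e.1.1, φ e.1.2), φ.map_adj e.2.1, hφ e.2.2⟩

theorem Edge.map_injective (φ : H →g G) (hφ : StrictMono φ) :
    Function.Injective (Edge.map φ hφ) := by
  intro e f h
  have h1 := congrArg (fun x => x.1.1) h
  have h2 := congrArg (fun x => x.1.2) h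
  exact Subtype.ext (Prod.ext (hφ.injective h1) (hφ.injective h2))

theorem Edge.map_avoids (φ : H →g G) (hφ : StrictMono φ) {e : Edge H} {w : W} :
    (e.map φ hφ).Avoids (φ w) ↔ e.Avoids w :=
  and_congr (hφ.injective.ne_iff) (hφ.injective.ne_iff)

theorem Edge.map_disjointFrom (φ : H →g G) (hφ : StrictMono φ) {e f : Edge H} :
    (e.map φ hφ).DisjointFrom (f.map φ hφ) ↔ e.DisjointFrom f :=
  and_congr (Edge.map_avoids φ hφ) (Edge.map_avoids φ hφ)

theorem Edge.incidence_map (φ : H →g G) (hφ : StrictMono φ) (e : Edge H) (w : V) :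
    (e.map φ hφ).incidence w =
      (if φ e.ini = w then 1 else 0) - (if φ e.ter = w then 1 else 0) := by
  simp only [Edge.incidence, eq_comm]
  rfl

theorem sum_mapDomain_incidence [Fintype (Edge G)] (φ : H →g G) (hφ : StrictMono φ)
    (z : Edge H →₀ ℤ) (w : V) :
    ∑ e, z.mapDomain (Edge.map φ hφ) e * e.incidence w =
      (graphBoundary H z).mapDomain φ w := by
  classical
  induction z using Finsupp.induction_linear with
  | zero => simp
  | add a b ha hb =>
    simp [Finsupp.mapDomain_add, add_mul, Finset.sum_add_distrib, ha, hb]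
  | single e c =>
    have hb : graphBoundary H (Finsupp.single e c) =
        Finsupp.single e.ini c - Finsupp.single e.ter c := by
      simp [graphBoundary, smul_sub]
    rw [hb]
    simp [Finsupp.single_apply, Finsupp.mapDomain_sub, Edge.incidence_map, mul_sub]

/-- Extension by zero along φ is injective and commutes with the boundary. It places the cycles of
all subgraphs in the single module `Edge G → ℤ`, where they can be compared. -/
theorem betti₁_eq_finrank_cycles [Fintype (Edge G)] (φ : H →g G) (hφ : StrictMono φ) :
    betti₁ H = Module.finrank ℤ (cycles (Set.range (Edge.map φ hφ))) := by
  have hinj := Edge.map_injective φ hφ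
  let T : (Edge H →₀ ℤ) →ₗ[ℤ] (Edge G → ℤ) :=
    Finsupp.lcoeFun ∘ₗ Finsupp.lmapDomain ℤ ℤ (Edge.map φ hφ)
  have hTa : ∀ z e, T z e = z.mapDomain (Edge.map φ hφ) e := fun z e => rfl
  have hTinj : Function.Injective T :=
    DFunLike.coe_injective.comp (Finsupp.mapDomain_injective hinj)
  rw [betti₁, homologyRank_zero_left,
    (Submodule.equivMapOfInjective T hTinj (LinearMap.ker (graphBoundary H))).finrank_eq]
  have h : Submodule.map T (LinearMap.ker (graphBoundary H)) =
      cycles (Set.range (Edge.map φ hφ)) := by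
    ext z
    constructor
    · rintro ⟨y, hy, rfl⟩
      refine ⟨fun e he => Finsupp.mapDomain_of_notMem_range _ _ he, fun w => ?_⟩
      simp only [hTa]
      rw [sum_mapDomain_incidence, LinearMap.mem_ker.1 hy]
      simp
    · rintro ⟨h1, h2⟩
      let z' : Edge G →₀ ℤ := Finsupp.equivFunOnFinite.symm z
      let y := Finsupp.comapDomain (Edge.map φ hφ) z' hinj.injOn
      have hy : ∀ e, y.mapDomain (Edge.map φ hφ) e = z e := by
        intro e
        by_cases he : e ∈ Set.range (Edge.map φ hφ)
        · obtain ⟨x, rfl⟩ := he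
          rw [Finsupp.mapDomain_apply hinj]
          simp [y, z']
        · rw [Finsupp.mapDomain_of_notMem_range _ _ he, h1 e he]
      refine ⟨y, LinearMap.mem_ker.2 ?_, funext hy⟩
      apply Finsupp.mapDomain_injective hφ.injective
      ext w
      rw [← sum_mapDomain_incidence φ hφ]
      simp [hy, h2 w]
  rw [h]

/-- A `2`-cell of `D₂(H)` as an ordered pair of edges of `G`. -/
def Cell₂.toPair (φ : H →g G) (hφ : StrictMono φ) (c : Cell₂ H) : Edge G × Edge G :=
  (c.1.1.map φ hφ, c.1.2.map φ hφ)

/-- A `1`-cell of `D₂(H)` as a pair of an edge and a vertex of `G`. -/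
def Cell₁.toPair (φ : H →g G) (hφ : StrictMono φ) (c : Cell₁ H) : Edge G × V :=
  (c.1.1.map φ hφ, φ c.1.2)

theorem Cell₂.toPair_injective (φ : H →g G) (hφ : StrictMono φ) :
    Function.Injective (Cell₂.toPair φ hφ) := by
  intro c d h
  exact Subtype.ext (Prod.ext (Edge.map_injective φ hφ (congrArg Prod.fst h))
    (Edge.map_injective φ hφ (congrArg Prod.snd h)))

theorem Cell₁.toPair_injective (φ : H →g G) (hφ : StrictMono φ) :
    Function.Injective (Cell₁.toPair φ hφ) := by
  intro c d h
  exact Subtype.ext (Prod.ext (Edge.map_injective φ hφ (congrArg Prod.fst h))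
    (hφ.injective (congrArg Prod.snd h)))

/-- Each unordered pair of edges is listed in one order only, so antisymmetrization never cancels or
doubles a coefficient. -/
theorem Cell₂.swap_toPair_notMem_range (φ : H →g G) (hφ : StrictMono φ) (c : Cell₂ H) :
    (Cell₂.toPair φ hφ c).swap ∉ Set.range (Cell₂.toPair φ hφ) := by
  rintro ⟨d, hd⟩
  have h1 := Edge.map_injective φ hφ (congrArg Prod.fst hd)
  have h2 := Edge.map_injective φ hφ (congrArg Prod.snd hd)
  have h3 := d.2.2
  rw [h1, h2] at h3
  exact lt_asymm h3 c.2.2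

/-- Antisymmetrized extension by zero of `2`-chains. -/
noncomputable def antisymm (φ : H →g G) (hφ : StrictMono φ) :
    (Cell₂ H →₀ ℤ) →ₗ[ℤ] (Edge G × Edge G → ℤ) where
  toFun a p := a.mapDomain (Cell₂.toPair φ hφ) p - a.mapDomain (Cell₂.toPair φ hφ) p.swap
  map_add' a b := by
    ext p
    simp only [Finsupp.mapDomain_add, Finsupp.add_apply, Pi.add_apply]
    ring
  map_smul' c a := by
    ext p
    simp only [Finsupp.mapDomain_smul, Finsupp.smul_apply, Pi.smul_apply, smul_eq_mul,
      RingHom.id_apply]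
    ring

theorem antisymm_apply (φ : H →g G) (hφ : StrictMono φ) (a : Cell₂ H →₀ ℤ)
    (p : Edge G × Edge G) : antisymm φ hφ a p =
      a.mapDomain (Cell₂.toPair φ hφ) p - a.mapDomain (Cell₂.toPair φ hφ) p.swap := rfl

theorem antisymm_toPair (φ : H →g G) (hφ : StrictMono φ) (a : Cell₂ H →₀ ℤ) (c : Cell₂ H) :
    antisymm φ hφ a (Cell₂.toPair φ hφ c) = a c := by
  rw [antisymm_apply, Finsupp.mapDomain_apply (Cell₂.toPair_injective φ hφ),
    Finsupp.mapDomain_of_notMem_range _ _ (Cell₂.swap_toPair_notMem_range φ hφ c), sub_zero]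

theorem antisymm_injective (φ : H →g G) (hφ : StrictMono φ) :
    Function.Injective (antisymm φ hφ) := by
  intro a b h
  ext c
  rw [← antisymm_toPair φ hφ, h, antisymm_toPair]

/-- A cell {x, y} becomes (x, y) - (y, x). Taking the boundary in the first variable gives ∂x at y
minus ∂y at x, which is the opposite of the sign convention in `confBoundary₂`. -/
theorem sum_antisymm_incidence [Fintype (Edge G)] (φ : H →g G) (hφ : StrictMono φ)
    (a : Cell₂ H →₀ ℤ) (f : Edge G) (w : V) :
    ∑ e, antisymm φ hφ a (e, f) * e.incidence w =
      -(confBoundary₂ H a).mapDomain (Cell₁.toPair φ hφ) (f, w) := by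
  classical
  induction a using Finsupp.induction_linear with
  | zero => simp
  | add a b ha hb =>
    simp only [map_add, Pi.add_apply, add_mul, Finset.sum_add_distrib, ha, hb,
      Finsupp.mapDomain_add, Finsupp.add_apply, neg_add]
  | single c n =>
    have key : ∀ x y : Edge G, ∑ e, (if (x, y) = (e, f) then n else 0) * e.incidence w =
        if y = f then n * x.incidence w else 0 := by
      intro x y
      by_cases h : y = f <;> simp [h]
    simp only [antisymm_apply, Finsupp.mapDomain_single, Finsupp.single_apply, sub_mul,
      Finset.sum_sub_distrib, Prod.swap_prod_mk]
    have hsw : ∀ e, (Cell₂.toPair φ hφ c = (f, e)) = ((c.1.2.map φ hφ, c.1.1.map φ hφ) = (e, f)) := by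
      intro e
      simp only [Cell₂.toPair, Prod.mk.injEq, and_comm]
    simp only [hsw]
    rw [Cell₂.toPair, key, key]
    have hb : confBoundary₂ H (Finsupp.single c n) =
        -(Finsupp.single (mkCell₁ c.1.2 c.1.1.ini c.2.1.symm.1) n
          - Finsupp.single (mkCell₁ c.1.2 c.1.1.ter c.2.1.symm.2) n)
        + (Finsupp.single (mkCell₁ c.1.1 c.1.2.ini c.2.1.1) n
          - Finsupp.single (mkCell₁ c.1.1 c.1.2.ter c.2.1.2) n) := by
      simp [confBoundary₂, smul_add, smul_sub]
    have hJ : ∀ e v h, Cell₁.toPair φ hφ (mkCell₁ e v h) = (e.map φ hφ, φ v) := fun _ _ _ => rfl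
    rw [hb]
    simp only [neg_sub, Finsupp.mapDomain_add, Finsupp.mapDomain_sub, Finsupp.mapDomain_single,
      Finsupp.single_apply, Finsupp.add_apply, Finsupp.sub_apply, hJ, Prod.mk.injEq, ite_and,
      Edge.incidence_map]
    by_cases h1 : c.1.1.map φ hφ = f <;> by_cases h2 : c.1.2.map φ hφ = f <;>
      simp only [h1, h2, if_true, if_false, mul_sub, mul_ite, mul_one, mul_zero] <;> ring

theorem betti₂D₂_eq_finrank_pairCycles [Fintype (Edge G)] (φ : H →g G) (hφ : StrictMono φ) :
    betti₂D₂ H = Module.finrank ℤ (pairCycles (Set.range (Edge.map φ hφ))) := by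
  have hinj := Cell₂.toPair_injective φ hφ
  rw [betti₂D₂, homologyRank_zero_left,
    (Submodule.equivMapOfInjective _ (antisymm_injective φ hφ)
      (LinearMap.ker (confBoundary₂ H))).finrank_eq]
  have h : Submodule.map (antisymm φ hφ) (LinearMap.ker (confBoundary₂ H)) =
      pairCycles (Set.range (Edge.map φ hφ)) := by
    ext A
    constructor
    · rintro ⟨a, ha, rfl⟩
      refine ⟨fun e f => ?_, fun e f h => ?_, fun f w => ?_⟩
      · simp [antisymm_apply]
      · have h1 : (e, f) ∉ Set.range (Cell₂.toPair φ hφ) := by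
          rintro ⟨c, hc⟩
          obtain ⟨rfl, rfl⟩ := Prod.mk.inj hc
          exact h ⟨⟨_, rfl⟩, ⟨_, rfl⟩, (Edge.map_disjointFrom φ hφ).2 c.2.1⟩
        have h2 : (f, e) ∉ Set.range (Cell₂.toPair φ hφ) := by
          rintro ⟨c, hc⟩
          obtain ⟨rfl, rfl⟩ := Prod.mk.inj hc
          exact h ⟨⟨_, rfl⟩, ⟨_, rfl⟩, (Edge.map_disjointFrom φ hφ).2 c.2.1.symm⟩
        rw [antisymm_apply, Finsupp.mapDomain_of_notMem_range _ _ h1, Prod.swap_prod_mk,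
          Finsupp.mapDomain_of_notMem_range _ _ h2, sub_zero]
      · rw [sum_antisymm_incidence, LinearMap.mem_ker.1 ha]
        simp
    · rintro ⟨h1, h2, h3⟩
      let A' : Edge G × Edge G →₀ ℤ := Finsupp.equivFunOnFinite.symm A
      let a := Finsupp.comapDomain (Cell₂.toPair φ hφ) A' hinj.injOn
      have hac : ∀ c, a c = A (Cell₂.toPair φ hφ c) := by
        intro c
        simp [a, A']
      have hsw : ∀ e f, antisymm φ hφ a (e, f) = -antisymm φ hφ a (f, e) := by
        simp [antisymm_apply]
      have key : antisymm φ hφ a = A := by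
        ext ⟨e, f⟩
        by_cases h : e ∈ Set.range (Edge.map φ hφ) ∧ f ∈ Set.range (Edge.map φ hφ) ∧
            e.DisjointFrom f
        · obtain ⟨⟨e, rfl⟩, ⟨f, rfl⟩, hd⟩ := h
          have hd' := (Edge.map_disjointFrom φ hφ).1 hd
          -- Exactly one of the two orders is a listed cell; antisymmetry of both sides settles the
          -- other.
          rcases lt_or_gt_of_ne hd'.ter_ne with hlt | hlt
          · exact (antisymm_toPair φ hφ a ⟨(e, f), hd', hlt⟩).trans (hac _)
          · rw [hsw, h1]
            exact congrArg _ ((antisymm_toPair φ hφ a ⟨(f, e), hd'.symm, hlt⟩).trans (hac _))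
        · have n1 : (e, f) ∉ Set.range (Cell₂.toPair φ hφ) := by
            rintro ⟨c, hc⟩
            obtain ⟨rfl, rfl⟩ := Prod.mk.inj hc
            exact h ⟨⟨_, rfl⟩, ⟨_, rfl⟩, (Edge.map_disjointFrom φ hφ).2 c.2.1⟩
          have n2 : (f, e) ∉ Set.range (Cell₂.toPair φ hφ) := by
            rintro ⟨c, hc⟩
            obtain ⟨rfl, rfl⟩ := Prod.mk.inj hc
            exact h ⟨⟨_, rfl⟩, ⟨_, rfl⟩, (Edge.map_disjointFrom φ hφ).2 c.2.1.symm⟩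
          rw [antisymm_apply, Finsupp.mapDomain_of_notMem_range _ _ n1, Prod.swap_prod_mk,
            Finsupp.mapDomain_of_notMem_range _ _ n2, sub_zero, h2 e f h]
      refine ⟨a, LinearMap.mem_ker.2 ?_, key⟩
      apply Finsupp.mapDomain_injective (Cell₁.toPair_injective φ hφ)
      ext ⟨f, w⟩
      have := sum_antisymm_incidence φ hφ a f w
      rw [key, h3] at this
      simpa using this.symm
  rw [h]

end Cycles

end GraphConfig

namespace GraphConfig

/-! ### Ranks of tensor-like modules with a vanishing condition -/

section LinearAlgebra

/-- The range of ρ is a subgroup of a free abelian group of finite rank, hence free. So M splits as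
kernel plus range. -/
theorem exists_basis_adapted_to_ker {M N : Type*} [AddCommGroup M] [Module.Free ℤ M]
    [Module.Finite ℤ M] [AddCommGroup N] [Module.Free ℤ N] [Module.Finite ℤ N]
    (ρ : M →ₗ[ℤ] N) :
    ∃ (r : ℕ) (b : Module.Basis (Fin (Module.finrank ℤ (LinearMap.ker ρ)) ⊕ Fin r) ℤ M),
      ∀ x, ρ x = 0 ↔ ∀ l, b.repr x (Sum.inr l) = 0 := by
  obtain ⟨s, hs⟩ := Module.projective_lifting_property ρ.rangeRestrict LinearMap.id
    (LinearMap.surjective_rangeRestrict ρ)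
  have hs' : ∀ y, ρ (s y) = y := fun y => congrArg Subtype.val (LinearMap.congr_fun hs y)
  have hρ : ∀ x, ρ.rangeRestrict x = 0 ↔ ρ x = 0 := fun x => by
    rw [Subtype.ext_iff]; rfl
  let e : M ≃ₗ[ℤ] LinearMap.ker ρ × LinearMap.range ρ :=
    { toFun := fun x => (⟨x - s (ρ.rangeRestrict x), by simp [hs']⟩, ρ.rangeRestrict x)
      map_add' := fun x y => by
        ext <;> simp
        abel
      map_smul' := fun c x => by
        ext <;> simp [smul_sub]
      invFun := fun p => p.1 + s p.2
      left_inv := fun x => by simp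
      right_inv := fun p => by
        have h1 : ρ.rangeRestrict (p.1 + s p.2) = p.2 := by
          ext
          simp [hs']
        ext
        · simp only [h1, add_sub_cancel_right]
        · simp only [h1] }
  let b := ((Module.finBasis ℤ (LinearMap.ker ρ)).prod
    (Module.finBasis ℤ (LinearMap.range ρ))).map e.symm
  refine ⟨_, b, fun x => ?_⟩
  have hb : ∀ l, b.repr x (Sum.inr l) =
      (Module.finBasis ℤ (LinearMap.range ρ)).repr (ρ.rangeRestrict x) l := fun l => by
    simp [b, e]
  simp only [hb]
  rw [← hρ, ← (Module.finBasis ℤ (LinearMap.range ρ)).repr.map_eq_zero_iff, Finsupp.ext_iff]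
  rfl

variable {E F : Type*}

/-- The functions in `M` that vanish on `R`. -/
def vanishingOn (M : Submodule ℤ (E → ℤ)) (R : Set E) : Submodule ℤ (E → ℤ) where
  carrier := {x | x ∈ M ∧ ∀ e ∈ R, x e = 0}
  zero_mem' := ⟨M.zero_mem, by simp⟩
  add_mem' := fun ha hb => ⟨M.add_mem ha.1 hb.1, fun e he => by simp [ha.2 e he, hb.2 e he]⟩
  smul_mem' := fun c _ ha => ⟨M.smul_mem c ha.1, fun e he => by simp [ha.2 e he]⟩

/-- Functions of two variables, lying in `M` in the first variable and in `N` in the second,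
that vanish on `R × S`. -/
def biVanishingOn (M : Submodule ℤ (E → ℤ)) (N : Submodule ℤ (F → ℤ)) (R : Set E) (S : Set F) :
    Submodule ℤ (E × F → ℤ) where
  carrier := {A | (∀ f, (fun e => A (e, f)) ∈ M) ∧ (∀ e, (fun f => A (e, f)) ∈ N) ∧
    ∀ e ∈ R, ∀ f ∈ S, A (e, f) = 0}
  zero_mem' := ⟨fun _ => M.zero_mem, fun _ => N.zero_mem, by simp⟩
  add_mem' := fun ha hb => ⟨fun f => M.add_mem (ha.1 f) (hb.1 f),
    fun e => N.add_mem (ha.2.1 e) (hb.2.1 e),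
    fun e he f hf => by simp [ha.2.2 e he f hf, hb.2.2 e he f hf]⟩
  smul_mem' := fun c _ ha => ⟨fun f => M.smul_mem c (ha.1 f), fun e => N.smul_mem c (ha.2.1 e),
    fun e he f hf => by simp [ha.2.2 e he f hf]⟩

theorem finrank_ker_restrict (N : Submodule ℤ (F → ℤ)) (S : Set F) :
    Module.finrank ℤ (LinearMap.ker
      ((LinearMap.funLeft ℤ ℤ (Subtype.val : S → F)).comp N.subtype)) =
      Module.finrank ℤ (vanishingOn N S) := by
  rw [(Submodule.equivSubtypeMap N _).finrank_eq]
  have h : Submodule.map N.subtype (LinearMap.ker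
      ((LinearMap.funLeft ℤ ℤ (Subtype.val : S → F)).comp N.subtype)) = vanishingOn N S := by
    ext x
    constructor
    · rintro ⟨y, hy, rfl⟩
      exact ⟨y.2, fun e he => congrFun (LinearMap.mem_ker.1 hy) ⟨e, he⟩⟩
    · rintro ⟨hx, hx'⟩
      exact ⟨⟨x, hx⟩, LinearMap.mem_ker.2 (funext fun e => hx' e e.2), rfl⟩
  rw [h]

theorem exists_basis_adapted_to_vanishingOn [Finite F] (N : Submodule ℤ (F → ℤ)) (S : Set F) :
    ∃ (m r : ℕ) (b : Module.Basis (Fin m ⊕ Fin r) ℤ N),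
      Module.finrank ℤ (vanishingOn N S) = m ∧
      ∀ x : N, (∀ f ∈ S, (x : F → ℤ) f = 0) ↔ ∀ l, b.repr x (Sum.inr l) = 0 := by
  obtain ⟨r, b, hb⟩ := exists_basis_adapted_to_ker
    ((LinearMap.funLeft ℤ ℤ (Subtype.val : S → F)).comp N.subtype)
  refine ⟨_, r, b, (finrank_ker_restrict N S).symm, fun x => ?_⟩
  rw [← hb, funext_iff, Subtype.forall]
  rfl

/-- Take a basis of N whose first m vectors span the part vanishing on S, and expand A(e, ·) in it.
Coefficients of these m vectors range over all of M; those of the other r must vanish on R. The rank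
is thus m · rk M + r · rk(`vanishingOn M R`). -/
theorem finrank_biVanishingOn [Fintype E] [Finite F] {K : Type*} (w : K → E → ℤ)
    (M : Submodule ℤ (E → ℤ)) (hM : ∀ x, x ∈ M ↔ ∀ k, ∑ e, x e * w k e = 0)
    (N : Submodule ℤ (F → ℤ)) (R : Set E) (S : Set F) :
    (Module.finrank ℤ (biVanishingOn M N R S) : ℤ) =
      Module.finrank ℤ M * Module.finrank ℤ N -
        ((Module.finrank ℤ M : ℤ) - Module.finrank ℤ (vanishingOn M R)) *
        ((Module.finrank ℤ N : ℤ) - Module.finrank ℤ (vanishingOn N S)) := by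
  obtain ⟨m, r, b, hm, hb⟩ := exists_basis_adapted_to_vanishingOn N S
  let P : Fin m ⊕ Fin r → Submodule ℤ (E → ℤ) :=
    Sum.elim (fun _ => M) (fun _ => vanishingOn M R)
  have hPM : ∀ l, P l ≤ M := by
    rintro (l | l)
    · exact le_rfl
    · exact fun x hx => hx.1
  let a : (∀ l, P l) → E → N := fun c e => ∑ l, (c l : E → ℤ) e • b l
  let Ψ : (∀ l, P l) →ₗ[ℤ] (E × F → ℤ) :=
    { toFun := fun c p => (a c p.1 : F → ℤ) p.2
      map_add' := fun c d => by
        ext p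
        simp [a, add_mul, Finset.sum_add_distrib, -Fintype.sum_sum_type]
      map_smul' := fun n c => by
        ext p
        simp [a, mul_assoc, Finset.mul_sum, -Fintype.sum_sum_type] }
  have hΨ : ∀ c e f, Ψ c (e, f) = (a c e : F → ℤ) f := fun _ _ _ => rfl
  have hΨ' : ∀ c e f, Ψ c (e, f) = ∑ l, (c l : E → ℤ) e * (b l : F → ℤ) f := by
    intro c e f
    simp [hΨ, a, -Fintype.sum_sum_type]
  have hrepr : ∀ c e l, b.repr (a c e) l = (c l : E → ℤ) e := by
    intro c e l
    simp only [a]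
    rw [b.repr_sum_self]
  have hinj : Function.Injective Ψ := by
    intro c d h
    funext l
    ext e
    rw [← hrepr, ← hrepr]
    have : a c e = a d e := Subtype.ext (funext fun f => congrFun h (e, f))
    rw [this]
  have hrange : LinearMap.range Ψ = biVanishingOn M N R S := by
    ext A
    constructor
    · rintro ⟨c, rfl⟩
      refine ⟨fun f => ?_, fun e => (a c e).2, fun e he f hf => ?_⟩
      · have : (fun e => Ψ c (e, f)) = ∑ l, (b l : F → ℤ) f • (c l : E → ℤ) := by
          ext e
          rw [hΨ', Finset.sum_apply]
          exact Finset.sum_congr rfl fun l _ => mul_comm _ _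
        rw [this]
        exact M.sum_mem fun l _ => M.smul_mem _ (hPM l (c l).2)
      · refine (hb (a c e)).2 (fun l => ?_) f hf
        rw [hrepr]
        exact (c (Sum.inr l)).2.2 e he
    · rintro ⟨h1, h2, h3⟩
      let α : E → N := fun e => ⟨fun f => A (e, f), h2 e⟩
      -- Because M is cut out by linear equations, they can be applied to the N-valued function α
      -- and then read off in coordinates. For a non-saturated M such as 2ℤ the coefficients could
      -- leave M.
      have hcM : ∀ l, (fun e => b.repr (α e) l) ∈ M := by
        intro l
        rw [hM]
        intro k
        have hz : ∑ e, w k e • α e = 0 := by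
          ext f
          simpa [α, mul_comm] using (hM _).1 (h1 f) k
        have := congrArg (fun x => b.repr x l) hz
        simpa [mul_comm] using this
      have hcP : ∀ l, (fun e => b.repr (α e) l) ∈ P l := by
        rintro (l | l)
        · exact hcM _
        · refine ⟨hcM _, fun e he => ?_⟩
          exact (hb (α e)).1 (fun f hf => h3 e he f hf) l
      refine ⟨fun l => ⟨_, hcP l⟩, ?_⟩
      ext ⟨e, f⟩
      have : a (fun l => ⟨_, hcP l⟩) e = α e := b.sum_repr (α e)
      rw [hΨ, this]
  have hcard : Module.finrank ℤ N = m + r := by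
    simpa using Module.finrank_eq_card_basis b
  have hP : ∑ l, Module.finrank ℤ (P l) =
      m * Module.finrank ℤ M + r * Module.finrank ℤ (vanishingOn M R) := by
    have hl : ∀ l, Module.finrank ℤ (P (Sum.inl l)) = Module.finrank ℤ M := fun _ => rfl
    have hr : ∀ l, Module.finrank ℤ (P (Sum.inr l)) = Module.finrank ℤ (vanishingOn M R) :=
      fun _ => rfl
    simp only [Fintype.sum_sum_type, hl, hr, Finset.sum_const, Finset.card_univ, Fintype.card_fin,
      smul_eq_mul]
  have hK := LinearMap.finrank_range_of_inj hinj
  rw [hrange, Module.finrank_pi_fintype, hP] at hK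
  rw [hK, hcard, hm]
  push_cast
  ring

end LinearAlgebra

end GraphConfig

namespace GraphConfig

/-! ### Splitting cycles along a wedge vertex -/

section Decomposition

variable {V : Type*} [LinearOrder V] {G : SimpleGraph V} [Fintype (Edge G)]

omit [Fintype (Edge G)] in
theorem Edge.sum_incidence [Fintype V] (e : Edge G) : ∑ w, e.incidence w = 0 := by
  simp [Edge.incidence]

theorem mem_cycles {S : Set (Edge G)} {z : Edge G → ℤ} :
    z ∈ cycles S ↔ (∀ e ∉ S, z e = 0) ∧ ∀ w, ∑ e, z e * e.incidence w = 0 := Iff.rfl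

/-- This is the equational form required by `finrank_biVanishingOn`: the support condition becomes
orthogonality to indicators of the edges outside S. -/
theorem mem_cycles_iff_orthogonal [DecidableEq (Edge G)] {S : Set (Edge G)} {z : Edge G → ℤ} :
    z ∈ cycles S ↔ ∀ k : V ⊕ {e : Edge G // e ∉ S},
      ∑ e, z e * (Sum.elim (fun w e => e.incidence w) (fun f e => if e = f.1 then 1 else 0) :
        V ⊕ {e : Edge G // e ∉ S} → Edge G → ℤ) k e = 0 := by
  simp only [mem_cycles, Sum.forall, Sum.elim_inl, Sum.elim_inr, Subtype.forall, mul_ite, mul_one,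
    mul_zero, Finset.sum_ite_eq', Finset.mem_univ, if_true, and_comm]

theorem vanishingOn_cycles (S R : Set (Edge G)) : vanishingOn (cycles S) R = cycles (S \ R) := by
  ext z
  constructor
  · rintro ⟨⟨h1, h2⟩, h3⟩
    refine ⟨fun e he => ?_, h2⟩
    by_cases hS : e ∈ S
    · exact h3 e (by_contra fun hR => he ⟨hS, hR⟩)
    · exact h1 e hS
  · rintro ⟨h1, h2⟩
    exact ⟨⟨fun e he => h1 e fun h => he h.1, h2⟩, fun e he => h1 e fun h => h.2 he⟩

variable {ι : Type*}

/-- The colour classes of `col` partition the edges into pieces that meet only at `v`. -/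
def MeetOnlyAt (col : Edge G → ι) (v : V) : Prop :=
  ∀ e f, col e ≠ col f → ∀ w, ¬ e.Avoids w → ¬ f.Avoids w → w = v

/-- Away from v, all edges at w share one colour, so the filtered sum is the full sum or zero. At v
the coefficient then vanishes too, since the coefficients of any boundary add up to zero. -/
theorem MeetOnlyAt.sum_filter_eq_zero [DecidableEq ι] [Finite V] {col : Edge G → ι} {v : V}
    (h : MeetOnlyAt col v) {z : Edge G → ℤ} (hz : ∀ w, ∑ e, z e * e.incidence w = 0) (i : ι)
    (w : V) : ∑ e, (if col e = i then z e else 0) * e.incidence w = 0 := by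
  have := Fintype.ofFinite V
  have hne : ∀ w ≠ v, ∑ e, (if col e = i then z e else 0) * e.incidence w = 0 := by
    intro w hw
    by_cases hex : ∃ e, col e = i ∧ ¬ e.Avoids w
    · obtain ⟨e₀, rfl, he₀⟩ := hex
      rw [← hz w]
      refine Finset.sum_congr rfl fun e _ => ?_
      by_cases hc : col e = col e₀
      · rw [if_pos hc]
      · have : e.Avoids w := by
          by_contra hav
          exact hw (h e e₀ hc w hav he₀)
        rw [Edge.incidence_eq_zero this, mul_zero, mul_zero]
    · refine Finset.sum_eq_zero fun e _ => ?_
      by_cases hc : col e = i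
      · have : e.Avoids w := by
          by_contra hav
          exact hex ⟨e, hc, hav⟩
        rw [Edge.incidence_eq_zero this, mul_zero]
      · rw [if_neg hc, zero_mul]
  by_cases hw : w = v
  · have htot : ∑ w, ∑ e, (if col e = i then z e else 0) * e.incidence w = 0 := by
      rw [Finset.sum_comm]
      simp [← Finset.mul_sum, Edge.sum_incidence]
    rw [Finset.sum_eq_single v (fun w _ hw => hne w hw) (by simp)] at htot
    rw [hw, htot]
  · exact hne w hw

theorem MeetOnlyAt.filter_mem_cycles [DecidableEq ι] [Finite V] {col : Edge G → ι} {v : V}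
    (h : MeetOnlyAt col v) {z : Edge G → ℤ} (hz : ∀ w, ∑ e, z e * e.incidence w = 0) (i : ι) :
    (fun e => if col e = i then z e else 0) ∈ cycles {e | col e = i} :=
  ⟨fun _ he => if_neg he, h.sum_filter_eq_zero hz i⟩

-- A common vertex of two edges of different colours can only be v.
omit [Fintype (Edge G)] in
theorem MeetOnlyAt.disjointFrom_iff {col : Edge G → ι} {v : V} (h : MeetOnlyAt col v)
    {e f : Edge G} (hc : col e ≠ col f) : ¬ e.DisjointFrom f ↔ ¬ e.Avoids v ∧ ¬ f.Avoids v := by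
  have hini : ¬ f.Avoids f.ini := fun h => h.1 rfl
  have hter : ¬ f.Avoids f.ter := fun h => h.2 rfl
  constructor
  · intro hd
    by_cases h1 : e.Avoids f.ini
    · have h2 : ¬ e.Avoids f.ter := fun h2 => hd ⟨h1, h2⟩
      have := h e f hc _ h2 hter
      rw [← this]
      exact ⟨h2, hter⟩
    · have := h e f hc _ h1 hini
      rw [← this]
      exact ⟨h1, hini⟩
  · rintro ⟨h1, h2⟩ hd
    simp only [Edge.Avoids, not_and_or, not_not] at h2
    rcases h2 with rfl | rfl
    · exact h1 hd.1
    · exact h1 hd.2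

/-- Mixed `2`-cycles: pairs of an edge of colour `i` and an edge of colour `j`. -/
abbrev mixedCycles (col : Edge G → ι) (v : V) (i j : ι) : Submodule ℤ (Edge G × Edge G → ℤ) :=
  biVanishingOn (cycles {e | col e = i}) (cycles {e | col e = j})
    {e | ¬ e.Avoids v} {e | ¬ e.Avoids v}

theorem mixedCycles_eq_zero {col : Edge G → ι} {v : V} {i j : ι} {C : Edge G × Edge G → ℤ}
    (hC : C ∈ mixedCycles col v i j) {e f : Edge G} (h : ¬ (col e = i ∧ col f = j)) :
    C (e, f) = 0 := by
  rw [not_and_or] at h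
  rcases h with h | h
  · exact (hC.1 f).1 e h
  · exact (hC.2.1 e).1 f h

theorem pairCycles_mono {S T : Set (Edge G)} (h : S ⊆ T) : pairCycles S ≤ pairCycles T :=
  fun _ hA => ⟨hA.1, fun e f hef => hA.2.1 e f fun h' => hef ⟨h h'.1, h h'.2.1, h'.2.2⟩, hA.2.2⟩

theorem MeetOnlyAt.antisymm_mem_pairCycles {col : Edge G → ι} {v : V} (h : MeetOnlyAt col v)
    {i j : ι} (hij : i ≠ j) {C : Edge G × Edge G → ℤ} (hC : C ∈ mixedCycles col v i j) :
    (fun p => C p - C p.swap) ∈ pairCycles (Set.univ : Set (Edge G)) := by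
  have hd : ∀ e f, ¬ e.DisjointFrom f → C (e, f) = 0 := by
    intro e f hef
    by_cases hc : col e = i ∧ col f = j
    · have hne : col e ≠ col f := by rw [hc.1, hc.2]; exact hij
      obtain ⟨h1, h2⟩ := (h.disjointFrom_iff hne).1 hef
      exact hC.2.2 e h1 f h2
    · exact mixedCycles_eq_zero hC hc
  refine ⟨fun e f => by simp, fun e f hef => ?_, fun f w => ?_⟩
  · have hef' : ¬ e.DisjointFrom f := fun h' => hef ⟨trivial, trivial, h'⟩
    simp [hd e f hef', hd f e fun h' => hef' h'.symm]
  · simp only [sub_mul, Finset.sum_sub_distrib, Prod.swap_prod_mk]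
    rw [(hC.1 f).2 w, (hC.2.1 f).2 w, sub_zero]

/-- The map Ψ assembles a 2-cycle from its blocks; `hsame` and `hlt` recover each block from the
sum, which gives injectivity. Conversely, filtering a 2-cycle by colours yields its blocks. -/
theorem MeetOnlyAt.finrank_pairCycles [Finite V] [Fintype ι] [LinearOrder ι]
    {col : Edge G → ι} {v : V} (h : MeetOnlyAt col v) :
    Module.finrank ℤ (pairCycles (Set.univ : Set (Edge G))) =
      ∑ i, Module.finrank ℤ (pairCycles {e | col e = i}) +
      ∑ p : {p : ι × ι // p.1 < p.2}, Module.finrank ℤ (mixedCycles col v p.1.1 p.1.2) := by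
  let P := ∀ i, pairCycles {e | col e = i}
  let Q := ∀ p : {p : ι × ι // p.1 < p.2}, mixedCycles col v p.1.1 p.1.2
  let Ψ : (P × Q) →ₗ[ℤ] (Edge G × Edge G → ℤ) :=
    { toFun := fun x => ∑ i, (x.1 i : Edge G × Edge G → ℤ) +
        ∑ p, fun q => (x.2 p : Edge G × Edge G → ℤ) q - (x.2 p : Edge G × Edge G → ℤ) q.swap
      map_add' := fun x y => by
        ext q
        have h1 : ∀ i q, ((x + y).1 i : Edge G × Edge G → ℤ) q =
            (x.1 i : Edge G × Edge G → ℤ) q + (y.1 i : Edge G × Edge G → ℤ) q := fun _ _ => rfl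
        have h2 : ∀ p q, ((x + y).2 p : Edge G × Edge G → ℤ) q =
            (x.2 p : Edge G × Edge G → ℤ) q + (y.2 p : Edge G × Edge G → ℤ) q := fun _ _ => rfl
        simp only [Pi.add_apply, Finset.sum_apply, h1, h2, Finset.sum_sub_distrib,
          Finset.sum_add_distrib]
        ring
      map_smul' := fun n x => by
        ext q
        have h1 : ∀ i q, ((n • x).1 i : Edge G × Edge G → ℤ) q =
            n * (x.1 i : Edge G × Edge G → ℤ) q := fun _ _ => rfl
        have h2 : ∀ p q, ((n • x).2 p : Edge G × Edge G → ℤ) q =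
            n * (x.2 p : Edge G × Edge G → ℤ) q := fun _ _ => rfl
        simp only [Pi.add_apply, Finset.sum_apply, h1, h2, Pi.smul_apply,
          smul_eq_mul, RingHom.id_apply, mul_add, Finset.mul_sum, mul_sub] }
  have hΨ : ∀ x q, Ψ x q = ∑ i, (x.1 i : Edge G × Edge G → ℤ) q +
      ∑ p, ((x.2 p : Edge G × Edge G → ℤ) q - (x.2 p : Edge G × Edge G → ℤ) q.swap) := by
    intro x q
    simp [Ψ]
  have hB : ∀ (x : P) i e f, ¬ (col e = i ∧ col f = i) →
      (x i : Edge G × Edge G → ℤ) (e, f) = 0 :=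
    fun x i e f hef => (x i).2.2.1 e f fun h' => hef ⟨h'.1, h'.2.1⟩
  have hmem : ∀ x, Ψ x ∈ pairCycles (Set.univ : Set (Edge G)) := by
    intro x
    refine Submodule.add_mem _ (Submodule.sum_mem _ fun i _ => ?_) (Submodule.sum_mem _ fun p _ => ?_)
    · exact pairCycles_mono (Set.subset_univ _) (x.1 i).2
    · exact h.antisymm_mem_pairCycles p.2.ne (x.2 p).2
  have hsame : ∀ x e f, col e = col f →
      Ψ x (e, f) = (x.1 (col e) : Edge G × Edge G → ℤ) (e, f) := by
    intro x e f hc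
    rw [hΨ, Finset.sum_eq_single (col e) (fun i _ hi => hB x.1 i e f fun h' => hi h'.1.symm)
      (by simp), Finset.sum_eq_zero, add_zero]
    intro p _
    rw [mixedCycles_eq_zero (x.2 p).2, Prod.swap_prod_mk, mixedCycles_eq_zero (x.2 p).2, sub_zero]
    · rintro ⟨h1, h2⟩
      exact p.2.ne (by rw [← h1, ← h2, hc])
    · rintro ⟨h1, h2⟩
      exact p.2.ne (by rw [← h1, ← h2, hc])
  have hlt : ∀ x e f (hc : col e < col f),
      Ψ x (e, f) = (x.2 ⟨(col e, col f), hc⟩ : Edge G × Edge G → ℤ) (e, f) := by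
    intro x e f hc
    rw [hΨ, Finset.sum_eq_zero, zero_add, Finset.sum_eq_single ⟨(col e, col f), hc⟩]
    · rw [Prod.swap_prod_mk, mixedCycles_eq_zero (x.2 ⟨(col e, col f), hc⟩).2 (e := f) (f := e),
        sub_zero]
      exact fun h' => hc.ne' h'.1
    · intro p _ hp
      rw [mixedCycles_eq_zero (x.2 p).2, Prod.swap_prod_mk, mixedCycles_eq_zero (x.2 p).2, sub_zero]
      · rintro ⟨h1, h2⟩
        have := p.2
        rw [← h1, ← h2] at this
        exact lt_asymm hc this
      · rintro ⟨h1, h2⟩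
        exact hp (Subtype.ext (Prod.ext h1.symm h2.symm))
    · simp
    · intro i _
      refine hB x.1 i e f ?_
      rintro ⟨h1, h2⟩
      exact hc.ne (h1.trans h2.symm)
  have hinj : Function.Injective Ψ := by
    intro x y hxy
    refine Prod.ext ?_ ?_
    · funext i
      ext ⟨e, f⟩
      by_cases hc : col e = i ∧ col f = i
      · obtain ⟨rfl, hf⟩ := hc
        rw [← hsame x e f hf.symm, ← hsame y e f hf.symm, hxy]
      · rw [hB _ _ _ _ hc, hB _ _ _ _ hc]
    · funext p
      ext ⟨e, f⟩
      by_cases hc : col e = p.1.1 ∧ col f = p.1.2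
      · obtain ⟨⟨i, j⟩, hp⟩ := p
        obtain ⟨rfl, rfl⟩ := hc
        rw [← hlt x e f hp, ← hlt y e f hp, hxy]
      · rw [mixedCycles_eq_zero (x.2 p).2 hc, mixedCycles_eq_zero (y.2 p).2 hc]
  have hrange : LinearMap.range Ψ = pairCycles (Set.univ : Set (Edge G)) := by
    refine le_antisymm ?_ fun A hA => ?_
    · rintro _ ⟨x, rfl⟩
      exact hmem x
    -- Antisymmetry transfers the cycle condition from the first variable to the second.
    · have hrow : ∀ e w, ∑ f, A (e, f) * f.incidence w = 0 := by
        intro e w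
        rw [← neg_eq_zero, ← hA.2.2 e w, ← Finset.sum_neg_distrib]
        refine Finset.sum_congr rfl fun f _ => ?_
        rw [hA.1 f e, neg_mul]
      have hP : ∀ i, (fun q : Edge G × Edge G => if col q.1 = i ∧ col q.2 = i then A q else 0) ∈
          pairCycles {e | col e = i} := by
        intro i
        refine ⟨fun e f => ?_, fun e f hef => ?_, fun f w => ?_⟩
        · simp only [and_comm (a := col f = i)]
          split_ifs
          · exact hA.1 e f
          · simp
        · by_cases hc : col e = i ∧ col f = i
          · refine (if_pos hc).trans ?_
            exact hA.2.1 e f fun h' => hef ⟨hc.1, hc.2, h'.2.2⟩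
          · exact if_neg hc
        · by_cases hf : col f = i
          · simpa [hf] using h.sum_filter_eq_zero (hA.2.2 f) i w
          · simp [hf]
      have hQ : ∀ p : {p : ι × ι // p.1 < p.2}, (fun q : Edge G × Edge G =>
          if col q.1 = p.1.1 ∧ col q.2 = p.1.2 then A q else 0) ∈ mixedCycles col v p.1.1 p.1.2 := by
        rintro ⟨⟨i, j⟩, hp⟩
        refine ⟨fun f => ?_, fun e => ?_, fun e he f hf => ?_⟩
        · by_cases hf : col f = j
          · simpa [hf] using h.filter_mem_cycles (hA.2.2 f) i
          · simp only [hf, and_false, if_false]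
            exact Submodule.zero_mem _
        · by_cases he : col e = i
          · simpa [he] using h.filter_mem_cycles (hrow e) j
          · simp only [he, false_and, if_false]
            exact Submodule.zero_mem _
        · by_cases hc : col e = i ∧ col f = j
          · refine (if_pos hc).trans ?_
            have hne : col e ≠ col f := by rw [hc.1, hc.2]; exact hp.ne
            exact hA.2.1 e f fun h' => (h.disjointFrom_iff hne).2 ⟨he, hf⟩ h'.2.2
          · exact if_neg hc
      let x : P × Q := (fun i => ⟨_, hP i⟩, fun p => ⟨_, hQ p⟩)
      have hxlt : ∀ e f, col e < col f → Ψ x (e, f) = A (e, f) := by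
        intro e f hc
        rw [hlt x e f hc]
        simp [x]
      refine ⟨x, ?_⟩
      ext ⟨e, f⟩
      rcases lt_trichotomy (col e) (col f) with hc | hc | hc
      · exact hxlt e f hc
      · rw [hsame x e f hc]
        simp [x, hc]
      · rw [(hmem x).1, hxlt f e hc, ← hA.1 e f]
  have hK := LinearMap.finrank_range_of_inj hinj
  rw [hrange] at hK
  rw [hK, Module.finrank_prod, Module.finrank_pi_fintype, Module.finrank_pi_fintype]

theorem finrank_mixedCycles (col : Edge G → ι) (v : V) (i j : ι) :
    (Module.finrank ℤ (mixedCycles col v i j) : ℤ) =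
      Module.finrank ℤ (cycles {e | col e = i}) * Module.finrank ℤ (cycles {e | col e = j}) -
      ((Module.finrank ℤ (cycles {e | col e = i}) : ℤ) -
        Module.finrank ℤ (cycles {e | col e = i ∧ e.Avoids v})) *
      ((Module.finrank ℤ (cycles {e | col e = j}) : ℤ) -
        Module.finrank ℤ (cycles {e | col e = j ∧ e.Avoids v})) := by
  classical
  have hv : ∀ i, vanishingOn (cycles {e | col e = i}) {e | ¬ e.Avoids v} =
      cycles {e | col e = i ∧ e.Avoids v} := by
    intro i
    rw [vanishingOn_cycles]
    congr 1
    ext e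
    simp
  have h := finrank_biVanishingOn _ (cycles {e | col e = i})
    (fun _ => mem_cycles_iff_orthogonal) (cycles {e | col e = j}) {e | ¬ e.Avoids v}
    {e | ¬ e.Avoids v}
  rwa [hv i, hv j] at h

end Decomposition

/-! ### Wedge components as edge colours, and the Betti number formula -/

section Wedge

variable {V : Type*} [LinearOrder V] {G : SimpleGraph V}

theorem range_map_hom (H : G.Subgraph) (hH : StrictMono H.hom) :
    Set.range (Edge.map H.hom hH) = {e : Edge G | H.Adj e.ini e.ter} := by
  ext e
  constructor
  · rintro ⟨x, rfl⟩
    exact x.2.1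
  · intro he
    exact ⟨⟨(⟨e.ini, he.fst_mem⟩, ⟨e.ter, he.snd_mem⟩), he, e.2.2⟩, rfl⟩

theorem strictMono_hom (H : G.Subgraph) : StrictMono H.hom := fun _ _ h => h

theorem betti₁_coe [Fintype (Edge G)] (H : G.Subgraph) :
    betti₁ H.coe = Module.finrank ℤ (cycles {e : Edge G | H.Adj e.ini e.ter}) := by
  rw [betti₁_eq_finrank_cycles H.hom (strictMono_hom H), range_map_hom]

theorem betti₂D₂_coe [Fintype (Edge G)] (H : G.Subgraph) :
    betti₂D₂ H.coe = Module.finrank ℤ (pairCycles {e : Edge G | H.Adj e.ini e.ter}) := by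
  rw [betti₂D₂_eq_finrank_pairCycles H.hom (strictMono_hom H), range_map_hom]

theorem betti₂D₂_eq_finrank_univ [Fintype (Edge G)] :
    betti₂D₂ G = Module.finrank ℤ (pairCycles (Set.univ : Set (Edge G))) := by
  have h : Set.range (Edge.map (SimpleGraph.Hom.id : G →g G) strictMono_id) = Set.univ :=
    Set.range_eq_univ.2 fun e => ⟨e, rfl⟩
  rw [betti₂D₂_eq_finrank_pairCycles SimpleGraph.Hom.id strictMono_id, h]

variable {ι : Type*} {v : V} {Γ : ι → G.Subgraph}

theorem IsWedge.exists_adj (h : IsWedge G v Γ) (e : Edge G) : ∃ i, (Γ i).Adj e.ini e.ter := by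
  have : (⨆ i, Γ i).Adj e.ini e.ter := by
    rw [h.iSup_eq_top]
    exact e.2.1
  exact SimpleGraph.Subgraph.iSup_adj.1 this

omit [LinearOrder V] in
theorem IsWedge.adj_unique (h : IsWedge G v Γ) {a b : V} {i j : ι} (hi : (Γ i).Adj a b)
    (hj : (Γ j).Adj a b) : i = j := by
  by_contra hij
  have : (Γ i ⊓ Γ j).Adj a b := ⟨hi, hj⟩
  rw [h.inf_eq_singleton i j hij] at this
  simp at this

omit [LinearOrder V] in
theorem IsWedge.eq_of_mem (h : IsWedge G v Γ) {w : V} {i j : ι} (hij : i ≠ j)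
    (hi : w ∈ (Γ i).verts) (hj : w ∈ (Γ j).verts) : w = v := by
  have : w ∈ (Γ i ⊓ Γ j).verts := ⟨hi, hj⟩
  rw [h.inf_eq_singleton i j hij] at this
  simpa using this

/-- The component that contains an edge. -/
noncomputable def IsWedge.component (h : IsWedge G v Γ) (e : Edge G) : ι := (h.exists_adj e).choose

theorem IsWedge.component_eq_iff (h : IsWedge G v Γ) {e : Edge G} {i : ι} :
    h.component e = i ↔ (Γ i).Adj e.ini e.ter :=
  ⟨fun hi => hi ▸ (h.exists_adj e).choose_spec,
    fun hi => h.adj_unique (h.exists_adj e).choose_spec hi⟩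

theorem IsWedge.mem_verts_component (h : IsWedge G v Γ) {e : Edge G} {w : V}
    (hw : ¬ e.Avoids w) : w ∈ (Γ (h.component e)).verts := by
  have he := h.component_eq_iff.1 (rfl : h.component e = _)
  simp only [Edge.Avoids, not_and_or, not_not] at hw
  rcases hw with rfl | rfl
  · exact he.fst_mem
  · exact he.snd_mem

theorem IsWedge.meetOnlyAt (h : IsWedge G v Γ) : MeetOnlyAt h.component v :=
  fun _ _ hc _ he hf => h.eq_of_mem hc (h.mem_verts_component he) (h.mem_verts_component hf)

theorem cut_adj_iff (H : G.Subgraph) (v : V) (e : Edge G) :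
    (cut H v).Adj e.ini e.ter ↔ H.Adj e.ini e.ter ∧ e.Avoids v := by
  rw [cut, SimpleGraph.Subgraph.deleteVerts_adj]
  simp only [Set.mem_singleton_iff, Edge.Avoids]
  constructor
  · rintro ⟨-, h1, -, h2, h3⟩
    exact ⟨h3, Ne.symm h1, Ne.symm h2⟩
  · rintro ⟨h3, h1, h2⟩
    exact ⟨h3.fst_mem, Ne.symm h1, h3.snd_mem, Ne.symm h2, h3⟩

theorem IsWedge.betti₂D₂_eq [Finite V] {k : ℕ} {Γ : Fin k → G.Subgraph} (h : IsWedge G v Γ) :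
    (betti₂D₂ G : ℤ) = ∑ i, (betti₂D₂ (Γ i).coe : ℤ)
      + ∑ i, ∑ j ∈ Finset.Ioi i, ((betti₁ (Γ i).coe : ℤ) * betti₁ (Γ j).coe
        - mu (Γ i) v * mu (Γ j) v) := by
  have := Fintype.ofFinite (Edge G)
  have hset : ∀ i, {e : Edge G | (Γ i).Adj e.ini e.ter} = {e | h.component e = i} := by
    intro i
    ext e
    exact h.component_eq_iff.symm
  have h₂ : ∀ i, betti₂D₂ (Γ i).coe =
      Module.finrank ℤ (pairCycles {e | h.component e = i}) := by
    intro i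
    rw [betti₂D₂_coe, hset]
  have h₁ : ∀ i, betti₁ (Γ i).coe = Module.finrank ℤ (cycles {e | h.component e = i}) := by
    intro i
    rw [betti₁_coe, hset]
  have hc : ∀ i, betti₁ (cut (Γ i) v).coe =
      Module.finrank ℤ (cycles {e | h.component e = i ∧ e.Avoids v}) := by
    intro i
    have hcut : {e : Edge G | (cut (Γ i) v).Adj e.ini e.ter} =
        {e | h.component e = i ∧ e.Avoids v} := by
      ext e
      simp only [Set.mem_ofPred_eq, cut_adj_iff, h.component_eq_iff]
    rw [betti₁_coe, hcut]
  have hm : ∀ i j, (betti₁ (Γ i).coe : ℤ) * betti₁ (Γ j).coe - mu (Γ i) v * mu (Γ j) v =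
      Module.finrank ℤ (mixedCycles h.component v i j) := by
    intro i j
    rw [finrank_mixedCycles, mu, mu, h₁, h₁, hc, hc]
  simp only [hm, h₂]
  rw [betti₂D₂_eq_finrank_univ, h.meetOnlyAt.finrank_pairCycles]
  push_cast
  congr 1
  rw [Finset.sum_sigma']
  refine Finset.sum_bij' (fun p _ => ⟨p.1.1, p.1.2⟩) (fun q hq => ⟨(q.1, q.2), by simpa using hq⟩)
    ?_ ?_ ?_ ?_ ?_
  · intro p _
    simpa using p.2
  all_goals simp

end Wedge

end GraphConfig

theorem mainTheorem4 {V : Type*} [Finite V] [LinearOrder V] (G : SimpleGraph V) (v : V) :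
    (∀ Γ₁ Γ₂ : G.Subgraph, GraphConfig.IsWedge G v ![Γ₁, Γ₂] →
      (GraphConfig.betti₂D₂ G : ℤ) =
        GraphConfig.betti₂D₂ Γ₁.coe + GraphConfig.betti₂D₂ Γ₂.coe
        + GraphConfig.betti₁ (GraphConfig.cut Γ₁ v).coe * GraphConfig.betti₁ Γ₂.coe
        + GraphConfig.betti₁ Γ₁.coe * GraphConfig.betti₁ (GraphConfig.cut Γ₂ v).coe
        - GraphConfig.betti₁ (GraphConfig.cut Γ₁ v).coe
          * GraphConfig.betti₁ (GraphConfig.cut Γ₂ v).coe) ∧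
    (∀ (k : ℕ) (Γ : Fin k → G.Subgraph), GraphConfig.IsWedge G v Γ →
      (GraphConfig.betti₂D₂ G : ℤ) =
        ∑ i, (GraphConfig.betti₂D₂ (Γ i).coe : ℤ)
        + ∑ i, ∑ j ∈ Finset.Ioi i,
            ((GraphConfig.betti₁ (Γ i).coe : ℤ) * GraphConfig.betti₁ (Γ j).coe
              - GraphConfig.mu (Γ i) v * GraphConfig.mu (Γ j) v)) := by
  refine ⟨fun Γ₁ Γ₂ h => ?_, fun k Γ h => h.betti₂D₂_eq⟩
  have h0 : Finset.Ioi (0 : Fin 2) = {1} := by decide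
  have h1 : Finset.Ioi (1 : Fin 2) = ∅ := by decide
  have key := h.betti₂D₂_eq
  rw [Fin.sum_univ_two, Fin.sum_univ_two, h0, h1, Finset.sum_singleton, Finset.sum_empty] at key
  change _ = (GraphConfig.betti₂D₂ Γ₁.coe + GraphConfig.betti₂D₂ Γ₂.coe : ℤ) +
    ((GraphConfig.betti₁ Γ₁.coe : ℤ) * GraphConfig.betti₁ Γ₂.coe -
      GraphConfig.mu Γ₁ v * GraphConfig.mu Γ₂ v + 0) at key
  -- With μᵢ = bᵢ - cᵢ, the identity is b₁b₂ - μ₁μ₂ = c₁b₂ + b₁c₂ - c₁c₂.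
  rw [key, GraphConfig.mu, GraphConfig.mu]
  ring
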